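/- Let $R$ be a commutative artinian ring, $A$ an $R$-algebra that is finitely generated as an $R$-module, and $I$ an injective envelope of the $R$-module $R/\operatorname{rad}(R)$. Put $D=\operatorname{Hom}_R(-,I)$, $(-)^*=\operatorname{Hom}_A(-,A)$ and $\nu=D\circ(-)^*$, an additive functor from left $A$-modules to left $A$-modules, which is applied degreewise to complexes. Let $P^\bullet : \cdots\to 0\to P^{-1}\to P^{0}\to 0\to\cdots$ be a complex of finitely generated projective left $A$-modules concentrated in degrees $-1$ and $0$, and define the classes of modules $$\mathcal X_c(P^\bullet)=\{X\in\operatorname{mod}A:\operatorname{Hom}_{D(\operatorname{Mod}A)}(P^\bullet,X[1])=0\},\qquad \mathcal Y_c(P^\bullet)=\{X\in\operatorname{mod}A:\operatorname{Hom}_{D(\operatorname{Mod}A)}(P^\bullet,X)=0\},$$ where $\operatorname{mod}A$ denotes the finitely generated left $A$-modules. Assume that $P^\bullet$ is a tilting complex, that is, $\operatorname{Hom}(P^\bullet,P^\bullet[i])=0$ in $K^b(\operatorname{proj}A)$ for all $i\neq 0$, and $K^b(\operatorname{proj}A)$ is the smallest strictly full triangulated subcategory of itself that contains $\operatorname{add}(P^\bullet)$,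 the direct summands of finite direct sums of copies of $P^\bullet$. Then $\mathcal X_c(P^\bullet)$ and $\mathcal Y_c(P^\bullet)$ are closed under extensions, and the following hold. 1. $H^0(P^\bullet)$ belongs to $\mathcal X_c(P^\bullet)$, it is Ext-projective there, i.e. $\operatorname{Ext}^1_A(H^0(P^\bullet),X)=0$ for all $X\in\mathcal X_c(P^\bullet)$, and it generates $\mathcal X_c(P^\bullet)$, i.e. every $X\in\mathcal X_c(P^\bullet)$ is an epimorphic image of a finite direct sum of copies of $H^0(P^\bullet)$. 2. $H^{-1}(\nu(P^\bullet))$ belongs to $\mathcal Y_c(P^\bullet)$, it is Ext-injective there, i.e. $\operatorname{Ext}^1_A(Y,H^{-1}(\nu(P^\bullet)))=0$ for all $Y\in\mathcal Y_c(P^\bullet)$, and it cogenerates $\mathcal Y_c(P^\bullet)$, i.e. every $Y\in\mathcal Y_c(P^\bullet)$ embeds in a finite direct sum of copies of $H^{-1}(\nu(P^\bullet))$. -/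

import Mathlib

open CategoryTheory CategoryTheory.Limits

universe w v u

namespace TwoTermTilting

/-! ### General notions -/

section Abelian

variable {C : Type u} [Category.{v} C] [Abelian C] [HasExt.{w} C]

/-- `X` is an Ext-projective object of the full subcategory `S` of an abelian category: `S` is
closed under extensions, contains `X`, and `Ext¹(X, S) = 0`. -/
structure IsExtProjective (S : ObjectProperty C) (X : C) : Prop where
  closedUnderExtensions : S.IsClosedUnderExtensions
  mem : S X
  ext_eq_zero : ∀ Y : C, S Y → ∀ e : Abelian.Ext X Y 1, e = 0

/-- `X` is an Ext-injective object of the full subcategory `S` of an abelian category: `S` is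
closed under extensions, contains `X`, and `Ext¹(S, X) = 0`. -/
structure IsExtInjective (S : ObjectProperty C) (X : C) : Prop where
  closedUnderExtensions : S.IsClosedUnderExtensions
  mem : S X
  ext_eq_zero : ∀ Y : C, S Y → ∀ e : Abelian.Ext Y X 1, e = 0

end Abelian

/-- `add X`: the direct summands of finite direct sums of copies of `X`. (It is used in a
triangulated category, where every retract of an object is a direct summand of it.) -/
def addClosure {C : Type u} [Category.{v} C] [HasZeroMorphisms C] (X : C) : ObjectProperty C :=
  fun Y => ∃ (n : ℕ) (b : Bicone (fun _ : Fin n => X)),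
    Nonempty b.IsBilimit ∧ Nonempty (Retract Y b.pt)

/-- The map `i : N → I` is an injective envelope of the `R`-module `N`: `I` is an injective module
and `i` is an essential monomorphism. -/
structure IsInjectiveEnvelope {R : Type u} [CommRing R] {N I : Type u} [AddCommGroup N]
    [Module R N] [AddCommGroup I] [Module R I] (i : N →ₗ[R] I) : Prop where
  injective_module : Module.Injective R I
  injective_map : Function.Injective i
  essential : ∀ K : Submodule R I, K ⊓ LinearMap.range i = ⊥ → K = ⊥

/-! ### Generation and cogeneration by a module -/

section Generation

variable {A : Type u} [Ring A]

/-- `G` generates the class `S` of (finitely generated) modules: every module in `S` is an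
epimorphic image of a finite direct sum of copies of `G`. -/
def Generates (G : ModuleCat.{u} A) (S : ObjectProperty (ModuleCat.{u} A)) : Prop :=
  ∀ X : ModuleCat.{u} A, S X →
    ∃ (n : ℕ) (p : (Fin n → G) →ₗ[A] X), Function.Surjective p

/-- `G` cogenerates the class `S` of (finitely generated) modules: every module in `S` embeds in a
finite direct sum of copies of `G`. -/
def Cogenerates (G : ModuleCat.{u} A) (S : ObjectProperty (ModuleCat.{u} A)) : Prop :=
  ∀ X : ModuleCat.{u} A, S X →
    ∃ (n : ℕ) (j : X →ₗ[A] (Fin n → G)), Function.Injective j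

end Generation

/-! ### Complexes of finitely generated projective modules, tilting complexes -/

section Complexes

variable {A : Type u} [Ring A]

/-- `P` is a bounded complex of finitely generated projective left `A`-modules, that is, an
object of `Kᵇ(proj A)`. -/
structure IsBoundedProj (P : CochainComplex (ModuleCat.{u} A) ℤ) : Prop where
  finite : ∀ n : ℤ, Module.Finite A (P.X n)
  projective : ∀ n : ℤ, Module.Projective A (P.X n)
  bounded : ∃ a b : ℤ, P.IsStrictlyGE a ∧ P.IsStrictlyLE b

/-- `P` is concentrated in the (cohomological) degrees `-1` and `0`. -/
structure IsTwoTerm (P : CochainComplex (ModuleCat.{u} A) ℤ) : Prop where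
  strictlyGE : P.IsStrictlyGE (-1)
  strictlyLE : P.IsStrictlyLE 0

/-- Tilting complexes in the sense of Rickard: `P` is an object of `Kᵇ(proj A)`,
`Hom(P, P[i]) = 0` for `i ≠ 0`, and `add P` generates `Kᵇ(proj A)` as a triangulated category
(every strictly full triangulated subcategory that contains `add P` contains `Kᵇ(proj A)`). -/
structure IsTiltingComplex (P : CochainComplex (ModuleCat.{u} A) ℤ) : Prop where
  isBoundedProj : IsBoundedProj P
  hom_shift_eq_zero : ∀ i : ℤ, i ≠ 0 →
    ∀ f : (HomotopyCategory.quotient (ModuleCat.{u} A) (ComplexShape.up ℤ)).obj P ⟶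
      ((HomotopyCategory.quotient (ModuleCat.{u} A) (ComplexShape.up ℤ)).obj P)⟦i⟧, f = 0
  generates : ∀ T : ObjectProperty (HomotopyCategory (ModuleCat.{u} A) (ComplexShape.up ℤ)),
    T.IsTriangulated → T.IsClosedUnderIsomorphisms →
    addClosure ((HomotopyCategory.quotient (ModuleCat.{u} A) (ComplexShape.up ℤ)).obj P) ≤ T →
    ∀ Q : CochainComplex (ModuleCat.{u} A) ℤ, IsBoundedProj Q →
      T ((HomotopyCategory.quotient (ModuleCat.{u} A) (ComplexShape.up ℤ)).obj Q)

end Complexes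

/-! ### The classes `𝒳`, `𝒴` of modules defined by a complex -/

section TorsionPair

variable {A : Type u} [Ring A] [HasDerivedCategory.{w} (ModuleCat.{u} A)]

/-- `𝒳(P)`: the modules `X` with `Hom(P, X[1]) = 0` in the derived category `D(Mod A)`. -/
def classX (P : CochainComplex (ModuleCat.{u} A) ℤ) : ObjectProperty (ModuleCat.{u} A) :=
  fun X => ∀ f : DerivedCategory.Q.obj P ⟶
    ((DerivedCategory.singleFunctor (ModuleCat.{u} A) 0).obj X)⟦(1 : ℤ)⟧, f = 0

/-- `𝒴(P)`: the modules `X` with `Hom(P, X) = 0` in the derived category `D(Mod A)`. -/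
def classY (P : CochainComplex (ModuleCat.{u} A) ℤ) : ObjectProperty (ModuleCat.{u} A) :=
  fun X => ∀ f : DerivedCategory.Q.obj P ⟶
    (DerivedCategory.singleFunctor (ModuleCat.{u} A) 0).obj X, f = 0

/-- `𝒳_c(P)`: the finitely generated modules in `𝒳(P)`. -/
def classXc (P : CochainComplex (ModuleCat.{u} A) ℤ) : ObjectProperty (ModuleCat.{u} A) :=
  fun X => classX P X ∧ Module.Finite A X

/-- `𝒴_c(P)`: the finitely generated modules in `𝒴(P)`. -/
def classYc (P : CochainComplex (ModuleCat.{u} A) ℤ) : ObjectProperty (ModuleCat.{u} A) :=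
  fun X => classY P X ∧ Module.Finite A X

end TorsionPair

/-! ### The functor `ν = D ∘ (-)^*` -/

section Nakayama

variable (R : Type u) [CommRing R] (A : Type u) [Ring A] [Algebra R A]
  (I : Type u) [AddCommGroup I] [Module R I]

/-- For a left `A`-module `M`, the dual `D(M^*)` of the right `A`-module `M^* = Hom_A(M, A)`,
where `D = Hom_R(-, I)`. -/
def NakayamaDual (M : Type u) [AddCommGroup M] [Module A M] : Type u :=
  (M →ₗ[A] A) →ₗ[R] I

variable {A} (M : Type u) [AddCommGroup M] [Module A M]

instance : AddCommGroup (NakayamaDual R A I M) :=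
  inferInstanceAs (AddCommGroup ((M →ₗ[A] A) →ₗ[R] I))

/-- Right multiplication by `a` on `M^* = Hom_A(M, A)`, that is, `(h a)(x) = h(x) a`. -/
def starMul (a : A) : (M →ₗ[A] A) →ₗ[R] (M →ₗ[A] A) where
  toFun h :=
    { toFun := fun x => h x * a
      map_add' := fun x y => by rw [map_add, add_mul]
      map_smul' := fun b x => by simp [mul_assoc] }
  map_add' h k := by ext x; simp [add_mul]
  map_smul' r h := by ext x; simp

variable {R I M} in
/-- An element of `D(M^*)`, viewed as an `R`-linear map `M^* → I`. -/
def NakayamaDual.toLin (φ : NakayamaDual R A I M) : (M →ₗ[A] A) →ₗ[R] I := φ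

/-- The left `A`-module structure of `D(M^*)`: `(a φ)(h) = φ(h a)`. -/
instance : Module A (NakayamaDual R A I M) where
  smul a φ := φ.toLin.comp (starMul R M a)
  one_smul φ := LinearMap.ext fun h => congrArg φ.toLin (LinearMap.ext fun x => mul_one (h x))
  mul_smul a b φ := LinearMap.ext fun h => congrArg φ.toLin
    (LinearMap.ext fun x => (mul_assoc (h x) a b).symm)
  smul_zero _ := rfl
  smul_add _ _ _ := rfl
  add_smul a b φ := LinearMap.ext fun h =>
    (congrArg φ.toLin (LinearMap.ext fun x => mul_add (h x) a b)).trans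
      (map_add φ.toLin (starMul R M a h) (starMul R M b h))
  zero_smul φ := LinearMap.ext fun h =>
    (congrArg φ.toLin (LinearMap.ext fun x => mul_zero (h x))).trans (map_zero φ.toLin)

variable {M} {N : Type u} [AddCommGroup N] [Module A N]

/-- Precomposition with `f : M → N`, as an `R`-linear map `f^* : N^* → M^*`. -/
def starMap (f : M →ₗ[A] N) : (N →ₗ[A] A) →ₗ[R] (M →ₗ[A] A) where
  toFun h := h.comp f
  map_add' _ _ := rfl
  map_smul' _ _ := rfl

/-- The map `D(f^*) : D(M^*) → D(N^*)` induced by `f : M → N`. -/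
def nakayamaMap (f : M →ₗ[A] N) : NakayamaDual R A I M →ₗ[A] NakayamaDual R A I N where
  toFun φ := φ.toLin.comp (starMap R f)
  map_add' _ _ := rfl
  map_smul' _ φ := LinearMap.ext fun _ => congrArg φ.toLin rfl

variable (A)

/-- The functor `ν = D ∘ (-)^*` on left `A`-modules. -/
def nakayama : ModuleCat.{u} A ⥤ ModuleCat.{u} A where
  obj M := ModuleCat.of A (NakayamaDual R A I M)
  map f := ModuleCat.ofHom (nakayamaMap R I f.hom)
  map_id _ := rfl
  map_comp _ _ := rfl

instance : (nakayama R A I).Additive where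
  map_add {M N f g} := by
    refine ModuleCat.hom_ext (LinearMap.ext fun φ => LinearMap.ext fun h => ?_)
    refine Eq.trans (congrArg (NakayamaDual.toLin φ) ?_)
      (map_add (NakayamaDual.toLin φ) (starMap R f.hom h) (starMap R g.hom h))
    exact LinearMap.ext fun x => map_add h (f.hom x) (g.hom x)

/-- The complex `ν(P)`, with `ν` applied in each degree. -/
noncomputable def nakayamaComplex (P : CochainComplex (ModuleCat.{u} A) ℤ) :
    CochainComplex (ModuleCat.{u} A) ℤ :=
  ((nakayama R A I).mapHomologicalComplex (ComplexShape.up ℤ)).obj P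

end Nakayama

end TwoTermTilting

namespace TwoTermTilting

/-! ### Morphisms from a bounded above complex of projectives to a shifted object -/

section Homological

open CochainComplex HomComplex

variable {C : Type u} [Category.{v} C] [Abelian C]

/-! Write `d : P⁻¹ → P⁰`, `M = coker d = H⁰(P)` and `N = ker νd = H⁻¹(νP)`. Since `P` is
K-projective with two terms, `X` lies in `𝒳` iff `Hom(d, X)` is surjective (`extendable`), and in
`𝒴` iff `Hom(d, X)` is injective (`separated`), that is, iff `Hom(M, X) = 0`. The duality `D Hom(Q,
X) ≅ Hom(X, νQ)` for finitely generated projective `Q` (`toNakayama`), with `I` an injective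
cogenerator, gives the dual descriptions: `X ∈ 𝒳` iff `Hom(X, N) = 0`, and `X ∈ 𝒴` iff `Hom(X, νd)`
is surjective.

From `Hom(P, P[1]) = 0` every map `P⁻¹ → P⁰` is null-homotopic, hence `M ∈ 𝒳`. Then `Hom(M, N) = 0`,
which also says `N ∈ 𝒴`. Ext-projectivity of `M` comes from the presentation `P⁻¹ → P⁰ → M`, and
Ext-injectivity of `N` from the copresentation `N → νP⁻¹ → νP⁰` with `νP⁻¹` injective.

A module in both classes has no maps from any shift of `P`. As `P` generates `A`, such a module is
zero. Generation follows by a trace argument: the quotient of `X ∈ 𝒳` by the trace of `M` lies in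
both classes (`generates_cokernel`). Cogeneration is dual, with the reject of `N`
(`cogenerates_kernel`). -/

lemma forall_homotopyCategory_hom_eq_zero_iff (K L : CochainComplex C ℤ) (n : ℤ) :
    (∀ f : (HomotopyCategory.quotient C (ComplexShape.up ℤ)).obj K ⟶
      ((HomotopyCategory.quotient C (ComplexShape.up ℤ)).obj L)⟦n⟧, f = 0) ↔
    ∀ z : Cocycle K L n, z ∈ coboundaries K L n := by
  let e := ((HomotopyCategory.quotient C (ComplexShape.up ℤ)).commShiftIso n).app L
  constructor
  · intro h z
    rw [← CohomologyClass.toHom_mk_eq_zero_iff, ← cancel_mono e.hom, zero_comp]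
    exact h _
  · intro h f
    obtain ⟨x, hx⟩ := (CohomologyClass.toHom_bijective K L n).2 (f ≫ e.inv)
    obtain ⟨z, rfl⟩ := x.mk_surjective
    rw [(CohomologyClass.toHom_mk_eq_zero_iff z).2 (h z)] at hx
    rw [← cancel_mono e.inv, zero_comp, ← hx]

/-- K-projectivity makes localization bijective on morphisms out of `K`, so the derived category can
be replaced by the homotopy category. -/
lemma forall_derivedCategory_hom_eq_zero_iff [HasDerivedCategory.{w} C]
    (K L : CochainComplex C ℤ) [K.IsKProjective] (n : ℤ) :
    (∀ f : DerivedCategory.Q.obj K ⟶ (DerivedCategory.Q.obj L)⟦n⟧, f = 0) ↔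
    ∀ z : Cocycle K L n, z ∈ coboundaries K L n := by
  rw [← forall_homotopyCategory_hom_eq_zero_iff]
  let L' := (HomotopyCategory.quotient C (ComplexShape.up ℤ)).obj L
  let e := (DerivedCategory.quotientCompQhIso C).app K
  let e' : DerivedCategory.Qh.obj (L'⟦n⟧) ≅ (DerivedCategory.Q.obj L)⟦n⟧ :=
    (DerivedCategory.Qh.commShiftIso n).app L' ≪≫
      (CategoryTheory.shiftFunctor _ n).mapIso ((DerivedCategory.quotientCompQhIso C).app L)
  have hb := CochainComplex.IsKProjective.Qh_map_bijective K (L'⟦n⟧)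
  constructor
  · intro h f
    apply hb.1
    rw [Functor.map_zero, ← cancel_mono e'.hom, ← cancel_epi e.inv, zero_comp, comp_zero]
    exact h _
  · intro h f
    obtain ⟨g, hg⟩ := hb.2 (e.hom ≫ f ≫ e'.inv)
    rw [h g, Functor.map_zero] at hg
    rw [← cancel_mono e'.inv, ← cancel_epi e.hom, ← hg, zero_comp, comp_zero]

/-- The target lives in degree 0, so a cochain of degree `n` has only its component on `K.X (-n)`.
The condition is exactness of the complex `Hom(K, X)` at that spot. -/
lemma forall_cocycle_single_mem_coboundaries_iff (K : CochainComplex C ℤ) (X : C)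
    (p' p p'' n : ℤ) (hn : p + n = 0) (hp' : p' + 1 = p) (hp'' : p + 1 = p'') :
    (∀ z : Cocycle K ((singleFunctor C 0).obj X) n, z ∈ coboundaries _ _ n) ↔
    ∀ f : K.X p ⟶ X, K.d p' p ≫ f = 0 → ∃ g : K.X p'' ⟶ X, K.d p p'' ≫ g = f := by
  constructor
  · intro h f hf
    exact (Cocycle.toSingleMk_mem_coboundaries_iff f hn p' hp' hf p'' hp'').1 (h _)
  · intro h z
    obtain ⟨f, hf, rfl⟩ := Cocycle.toSingleMk_surjective z p hn p' hp'
    exact (Cocycle.toSingleMk_mem_coboundaries_iff f hn p' hp' hf p'' hp'').2 (h f hf)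

lemma forall_derivedCategory_hom_single_eq_zero_iff [HasDerivedCategory.{w} C]
    (K : CochainComplex C ℤ) [K.IsKProjective] (X : C)
    (p' p p'' n : ℤ) (hn : p + n = 0) (hp' : p' + 1 = p) (hp'' : p + 1 = p'') :
    (∀ f : DerivedCategory.Q.obj K ⟶
      ((DerivedCategory.singleFunctor C 0).obj X)⟦n⟧, f = 0) ↔
    ∀ f : K.X p ⟶ X, K.d p' p ≫ f = 0 → ∃ g : K.X p'' ⟶ X, K.d p p'' ≫ g = f := by
  rw [← forall_cocycle_single_mem_coboundaries_iff K X p' p p'' n hn hp' hp'',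
    ← forall_derivedCategory_hom_eq_zero_iff]
  let e := (CategoryTheory.shiftFunctor _ n).mapIso ((DerivedCategory.singleFunctorIsoCompQ C 0).app X)
  constructor
  · intro h f
    rw [← cancel_mono e.inv, zero_comp]
    exact h _
  · intro h f
    rw [← cancel_mono e.hom, zero_comp]
    exact h _

/-- The objects of the homotopy category that are isomorphic to a shift of `Y`. -/
def shiftsOf (Y : HomotopyCategory C (ComplexShape.up ℤ)) :
    ObjectProperty (HomotopyCategory C (ComplexShape.up ℤ)) :=
  fun Z => ∃ n : ℤ, Nonempty (Z ≅ Y⟦n⟧)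

instance (Y : HomotopyCategory C (ComplexShape.up ℤ)) :
    (shiftsOf Y).IsStableUnderShift ℤ where
  isStableUnderShiftBy a := ⟨fun _ ⟨n, ⟨e⟩⟩ =>
    ⟨n + a, ⟨(CategoryTheory.shiftFunctor _ a).mapIso e ≪≫ ((shiftFunctorAdd _ n a).app Y).symm⟩⟩⟩

lemma leftOrthogonal_shiftsOf_iff (Y Z : HomotopyCategory C (ComplexShape.up ℤ)) :
    (shiftsOf Y).leftOrthogonal Z ↔ ∀ (n : ℤ) (f : Z ⟶ Y⟦n⟧), f = 0 := by
  constructor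
  · intro h n f
    exact h f ⟨n, ⟨Iso.refl _⟩⟩
  · rintro h W f ⟨n, ⟨e⟩⟩
    rw [← cancel_mono e.hom, zero_comp]
    exact h n _

/-- Orthogonality to all shifts is acyclicity of `Hom(K, X)`. It is checked for `K = P` and then
exploited for `K = A` in degree 0. -/
lemma leftOrthogonal_shiftsOf_single_iff (K : CochainComplex C ℤ) (X : C) :
    (shiftsOf ((HomotopyCategory.quotient C (ComplexShape.up ℤ)).obj
        ((singleFunctor C 0).obj X))).leftOrthogonal
      ((HomotopyCategory.quotient C (ComplexShape.up ℤ)).obj K) ↔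
    ∀ (p' p p'' : ℤ), p' + 1 = p → p + 1 = p'' →
      ∀ f : K.X p ⟶ X, K.d p' p ≫ f = 0 → ∃ g : K.X p'' ⟶ X, K.d p p'' ≫ g = f := by
  rw [leftOrthogonal_shiftsOf_iff]
  constructor
  · intro h p' p p'' hp' hp''
    rw [← forall_cocycle_single_mem_coboundaries_iff K X p' p p'' (-p) (by simp) hp' hp'',
      ← forall_homotopyCategory_hom_eq_zero_iff]
    exact h _
  · intro h n
    rw [forall_homotopyCategory_hom_eq_zero_iff,
      forall_cocycle_single_mem_coboundaries_iff K X (-n - 1) (-n) (-n + 1) n (by simp)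
        (by simp) (by simp)]
    exact h _ _ _ (by simp) (by simp)

/-- A retract of a finite direct sum of copies of `Y` is left orthogonal to whatever `Y` is left
orthogonal to. -/
lemma addClosure_le_leftOrthogonal {D : Type u} [Category.{v} D] [Preadditive D]
    (S : ObjectProperty D) {Y : D} (hY : S.leftOrthogonal Y) :
    addClosure Y ≤ S.leftOrthogonal := by
  rintro Z ⟨n, b, ⟨hb⟩, ⟨r⟩⟩ W f hW
  have h : r.r ≫ f = 0 := hb.isColimit.hom_ext (fun ⟨j⟩ => by
    simpa using hY (b.ι j ≫ r.r ≫ f) hW)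
  rw [← Category.id_comp f, ← r.retract, Category.assoc, h, comp_zero]

/-- In a two-term complex `P` with `Hom(P, P[1]) = 0` in the homotopy category, every morphism
`P⁻¹ ⟶ P⁰` is null-homotopic. -/
lemma exists_eq_comp_d_add_d_comp {P : CochainComplex C ℤ} [P.IsStrictlyGE (-1)]
    [P.IsStrictlyLE 0]
    (h : ∀ f : (HomotopyCategory.quotient C (ComplexShape.up ℤ)).obj P ⟶
      ((HomotopyCategory.quotient C (ComplexShape.up ℤ)).obj P)⟦(1 : ℤ)⟧, f = 0)
    (f : P.X (-1) ⟶ P.X 0) :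
    ∃ (a : P.X (-1) ⟶ P.X (-1)) (b : P.X 0 ⟶ P.X 0), a ≫ P.d (-1) 0 + P.d (-1) 0 ≫ b = f := by
  rw [forall_homotopyCategory_hom_eq_zero_iff] at h
  -- The components of this coboundary go from degree `p` to `p + 2`, and one of the two lies
  -- outside `[-1, 0]`.
  have hz : δ 1 2 (Cochain.single f 1) = 0 := by
    ext p q hpq
    by_cases hp : p < -1
    · exact (P.isZero_of_isStrictlyGE (-1) p hp).eq_of_src _ _
    · exact (P.isZero_of_isStrictlyLE 0 q (by lia)).eq_of_tgt _ _
  obtain ⟨β, hβ⟩ := (mem_coboundaries_iff _ 0 (by simp)).1 (h (Cocycle.mk _ 2 rfl hz))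
  have := Cochain.congr_v hβ (-1) 0 (by simp)
  rw [δ_v 0 1 (by simp) β (-1) 0 (by simp) (-1) 0 (by simp) (by simp)] at this
  -- The minus sign compensates the sign in the differential of a degree 0 cochain.
  refine ⟨β.v (-1) (-1) (by simp), -β.v 0 0 (by simp), ?_⟩
  simpa using this

end Homological

/-! ### Objects with respect to which a morphism is surjective or injective -/

section Category

variable {C : Type u} [Category.{v} C] {P₁ P₀ : C}

/-- The objects `X` such that `Hom(d, X)` is surjective. -/
def extendable (d : P₁ ⟶ P₀) : ObjectProperty C :=
  fun X => ∀ f : P₁ ⟶ X, ∃ g : P₀ ⟶ X, d ≫ g = f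

lemma extendable_of_epi {d : P₁ ⟶ P₀} [Projective P₁] {X Y : C} (hX : extendable d X)
    (p : X ⟶ Y) [Epi p] :
    extendable d Y := fun f => by
  obtain ⟨g, hg⟩ := hX (Projective.factorThru f p)
  exact ⟨g ≫ p, by rw [reassoc_of% hg, Projective.factorThru_comp]⟩

end Category

section Abelian

variable {C : Type u} [Category.{v} C] [Abelian C]

/-- The objects `X` such that `Hom(d, X)` is injective. -/
def separated {P₁ P₀ : C} (d : P₁ ⟶ P₀) : ObjectProperty C :=
  fun X => ∀ g : P₀ ⟶ X, d ≫ g = 0 → g = 0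

section

variable {P₁ P₀ : C} (d : P₁ ⟶ P₀)

/-- Extend the image of `f` in the quotient and lift the extension along `S.g` using projectivity of
`P₀`. The error then lands in the subobject, where it extends as well. -/
lemma extendable_isClosedUnderExtensions [Projective P₁] [Projective P₀] :
    (extendable d).IsClosedUnderExtensions where
  prop_X₂_of_shortExact {S} hS h₁ h₃ f := by
    have := hS.mono_f
    have := hS.epi_g
    obtain ⟨g, hg⟩ := h₃ (f ≫ S.g)
    let g' := Projective.factorThru g S.g
    have hg' : (f - d ≫ g') ≫ S.g = 0 := by simp [g', hg]
    obtain ⟨k, hk⟩ := h₁ (hS.exact.lift _ hg')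
    refine ⟨g' + k ≫ S.f, ?_⟩
    rw [Preadditive.comp_add, reassoc_of% hk, hS.exact.lift_f]
    abel

lemma separated_isClosedUnderExtensions : (separated d).IsClosedUnderExtensions where
  prop_X₂_of_shortExact {S} hS h₁ h₃ g hg := by
    have := hS.mono_f
    have hg' : g ≫ S.g = 0 := h₃ _ (by rw [reassoc_of% hg, zero_comp])
    have hk : hS.exact.lift g hg' = 0 := h₁ _ (by
      rw [← cancel_mono S.f, Category.assoc, hS.exact.lift_f, hg, zero_comp])
    rw [← hS.exact.lift_f g hg', hk, zero_comp]

variable {d}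

lemma separated_of_mono {X Y : C} (hY : separated d Y) (i : X ⟶ Y) [Mono i] :
    separated d X := fun g hg => by
  rw [← cancel_mono i, zero_comp]
  exact hY _ (by rw [reassoc_of% hg, zero_comp])

/-- `Hom(d, Y)` is injective if and only if `Hom(coker d, Y) = 0`. -/
lemma separated_iff_of_exact {M : C} {π : P₀ ⟶ M} {w : d ≫ π = 0}
    (hd : (ShortComplex.mk d π w).Exact) [Epi π] (Y : C) :
    separated d Y ↔ ∀ f : M ⟶ Y, f = 0 := by
  constructor
  · intro h f
    rw [← cancel_epi π, comp_zero]
    exact h _ (by rw [reassoc_of% w, zero_comp])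
  · intro h g hg
    have : Epi (ShortComplex.mk d π w).g := ‹_›
    rw [← hd.g_desc g hg, h (hd.desc g hg), comp_zero]

/-- If every morphism `P₁ ⟶ P₀` is null-homotopic, then `Hom(d, coker d)` is surjective. -/
lemma extendable_of_exact [Projective P₁] {M : C} {π : P₀ ⟶ M} (w : d ≫ π = 0) [Epi π]
    (h : ∀ f : P₁ ⟶ P₀, ∃ (a : P₁ ⟶ P₁) (b : P₀ ⟶ P₀), a ≫ d + d ≫ b = f) :
    extendable d M := fun f => by
  obtain ⟨a, b, hab⟩ := h (Projective.factorThru f π)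
  refine ⟨b ≫ π, ?_⟩
  rw [← Projective.factorThru_comp f π, ← hab]
  simp [w]

end

/-! ### Vanishing of `Ext¹` and its consequences for lifting and extending morphisms -/

section Ext

variable [HasExt.{w} C]

/-- `Ext¹(M, X) = 0` for the cokernel `M` of a morphism `d` to a projective object, if `Hom(d, X)`
is surjective. -/
lemma ext_eq_zero_of_extendable {P₁ P₀ M : C} {d : P₁ ⟶ P₀} [Projective P₀] {π : P₀ ⟶ M}
    {w : d ≫ π = 0} (hd : (ShortComplex.mk d π w).Exact) [Epi π] {X : C}
    (hX : extendable d X) (e : Abelian.Ext M X 1) : e = 0 := by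
  let S := ShortComplex.mk (kernel.ι π) π (kernel.condition π)
  have hS : S.ShortExact :=
    { exact := ShortComplex.exact_kernel π
      mono_f := inferInstanceAs (Mono (kernel.ι π))
      epi_g := ‹_› }
  obtain ⟨x, hx⟩ := Abelian.Ext.contravariant_sequence_exact₃ hS X e
    (Abelian.Ext.eq_zero_of_projective _) (n₀ := 0) rfl
  obtain ⟨f, rfl⟩ := Abelian.Ext.homEquiv₀.symm.surjective x
  rw [Abelian.Ext.homEquiv₀_symm_apply] at hx
  -- The class `e` is the connecting image of some `f : ker π → X`. By exactness `P₁` covers `ker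
  -- π`, so an extension of `q ≫ f` along `d` already extends `f` to `P₀`, and the connecting image
  -- vanishes.
  let q : P₁ ⟶ kernel π := kernel.lift π d w
  have : Epi q := by
    have := hd.epi_kernelLift
    exact this
  obtain ⟨g, hg⟩ := hX (q ≫ f)
  have hf : f = S.f ≫ g := by
    rw [← cancel_epi q, ← hg, ← Category.assoc]
    congr 1
    exact (kernel.lift_ι π d w).symm
  rw [← hx, hf, ← Abelian.Ext.mk₀_comp_mk₀]
  exact hS.extClass_comp_assoc _

/-- `Ext¹(Y, N) = 0` for the kernel `N` of a morphism `c` from an injective object, if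
`Hom(Y, c)` is surjective. -/
lemma ext_eq_zero_of_forall_exists_lift {N J₁ J₀ : C} {i : N ⟶ J₁} {c : J₁ ⟶ J₀} [Injective J₁]
    {w : i ≫ c = 0} (hc : (ShortComplex.mk i c w).Exact) [Mono i] {Y : C}
    (hY : ∀ f : Y ⟶ J₀, ∃ g : Y ⟶ J₁, g ≫ c = f) (e : Abelian.Ext Y N 1) : e = 0 := by
  let S := ShortComplex.mk i (cokernel.π i) (cokernel.condition i)
  have hS : S.ShortExact :=
    { exact := ShortComplex.exact_cokernel i
      mono_f := ‹_›
      epi_g := inferInstanceAs (Epi (cokernel.π i)) }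
  obtain ⟨x, hx⟩ := Abelian.Ext.covariant_sequence_exact₁ Y hS e
    (Abelian.Ext.eq_zero_of_injective _) (n₀ := 0) rfl
  obtain ⟨f, rfl⟩ := Abelian.Ext.homEquiv₀.symm.surjective x
  rw [Abelian.Ext.homEquiv₀_symm_apply] at hx
  -- Dually, `e` comes from a map `f : Y → coker i`. Since `coker i` embeds in `J₀`, a lift of `f ≫
  -- q` through `c` is a lift of `f` to `J₁`.
  let q : cokernel i ⟶ J₀ := cokernel.desc i c w
  have : Mono q := by
    have := hc.mono_cokernelDesc
    exact this
  obtain ⟨g, hg⟩ := hY (f ≫ q)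
  have hf : f = g ≫ S.g := by
    rw [← cancel_mono q, ← hg, Category.assoc]
    congr 1
    exact (cokernel.π_desc i c w).symm
  rw [← hx, hf, ← Abelian.Ext.mk₀_comp_mk₀_assoc]
  exact (congrArg (fun z => (Abelian.Ext.mk₀ g).comp z (zero_add 1)) hS.comp_extClass).trans
    (Abelian.Ext.comp_zero _ _ _ _ _)

/-- The obstruction to lifting is the pullback of the extension class along `f`. -/
lemma exists_lift_of_ext_eq_zero {S : ShortComplex C} (hS : S.ShortExact) {M : C}
    (h : ∀ e : Abelian.Ext M S.X₁ 1, e = 0) (f : M ⟶ S.X₃) : ∃ g : M ⟶ S.X₂, g ≫ S.g = f := by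
  obtain ⟨x, hx⟩ := Abelian.Ext.covariant_sequence_exact₃ M hS (Abelian.Ext.mk₀ f)
    (n₁ := 1) rfl (h _)
  obtain ⟨g, rfl⟩ := Abelian.Ext.homEquiv₀.symm.surjective x
  refine ⟨g, Abelian.Ext.homEquiv₀.symm.injective ?_⟩
  simpa using hx

lemma exists_extension_of_ext_eq_zero {S : ShortComplex C} (hS : S.ShortExact) {N : C}
    (h : ∀ e : Abelian.Ext S.X₃ N 1, e = 0) (f : S.X₁ ⟶ N) : ∃ g : S.X₂ ⟶ N, S.f ≫ g = f := by
  obtain ⟨x, hx⟩ := Abelian.Ext.contravariant_sequence_exact₁ hS N (Abelian.Ext.mk₀ f)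
    (n₁ := 1) rfl (h _)
  obtain ⟨g, rfl⟩ := Abelian.Ext.homEquiv₀.symm.surjective x
  refine ⟨g, Abelian.Ext.homEquiv₀.symm.injective ?_⟩
  simpa using hx

end Ext

end Abelian

/-! ### The injective envelope of `R / rad R` over an artinian ring -/

section InjectiveEnvelope

variable {R : Type u} [CommRing R] {I : Type u} [AddCommGroup I] [Module R I]

/-- The elements of a module that are annihilated by an ideal. -/
def annihilatedBy (I : Type u) [AddCommGroup I] [Module R I] (𝔞 : Ideal R) : Submodule R I where
  carrier := {x | ∀ a ∈ 𝔞, a • x = 0}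
  add_mem' hx hy a ha := by rw [smul_add, hx a ha, hy a ha, add_zero]
  zero_mem' a _ := smul_zero a
  smul_mem' r x hx a ha := by rw [smul_comm, hx a ha, smul_zero]

/-- Multiplication by finitely many generators of `𝔟` maps the elements killed by `𝔞𝔟` into a finite
power of those killed by `𝔞`, and its kernel consists of elements killed by `𝔟`. -/
lemma isNoetherian_annihilatedBy_mul [IsNoetherianRing R] (𝔞 𝔟 : Ideal R)
    (h𝔞 : IsNoetherian R (annihilatedBy I 𝔞)) (h𝔟 : IsNoetherian R (annihilatedBy I 𝔟)) :
    IsNoetherian R (annihilatedBy I (𝔞 * 𝔟)) := by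
  obtain ⟨n, s, hs⟩ := Submodule.fg_iff_exists_fin_generating_family.1
    (IsNoetherian.noetherian 𝔟)
  have hsmem (j : Fin n) : s j ∈ 𝔟 := hs ▸ Submodule.subset_span ⟨j, rfl⟩
  let φ : annihilatedBy I (𝔞 * 𝔟) →ₗ[R] (Fin n → annihilatedBy I 𝔞) :=
    LinearMap.pi fun j => LinearMap.codRestrict _
      ((s j • LinearMap.id (R := R) (M := I)).comp (annihilatedBy I (𝔞 * 𝔟)).subtype)
      (fun x a ha => by
        have := x.2 (a * s j) (Ideal.mul_mem_mul ha (hsmem j))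
        simpa [mul_smul] using this)
  have hker : IsNoetherian R (LinearMap.ker φ) := by
    have hmem (x : LinearMap.ker φ) : (x : annihilatedBy I (𝔞 * 𝔟)).1 ∈ annihilatedBy I 𝔟 := by
      intro b hb
      have hle : 𝔟 ≤ LinearMap.ker (LinearMap.toSpanSingleton R I x.1.1) := by
        refine hs.ge.trans (Submodule.span_le.2 ?_)
        rintro _ ⟨j, rfl⟩
        exact congrArg Subtype.val (congrFun (LinearMap.mem_ker.1 x.2) j)
      simpa using hle hb
    let ψ : LinearMap.ker φ →ₗ[R] annihilatedBy I 𝔟 :=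
      LinearMap.codRestrict _
        ((annihilatedBy I (𝔞 * 𝔟)).subtype.comp (LinearMap.ker φ).subtype) hmem
    refine isNoetherian_of_injective ψ fun x y hxy => ?_
    exact Subtype.ext (Subtype.ext (congrArg (fun z : annihilatedBy I 𝔟 => (z : I)) hxy))
  have hrange : IsNoetherian R (LinearMap.range φ) := inferInstance
  exact isNoetherian_of_range_eq_ker (LinearMap.ker φ).subtype φ.rangeRestrict (by simp)

lemma isNoetherian_annihilatedBy_pow [IsNoetherianRing R] (𝔞 : Ideal R)
    (h𝔞 : IsNoetherian R (annihilatedBy I 𝔞)) (n : ℕ) :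
    IsNoetherian R (annihilatedBy I (𝔞 ^ n)) := by
  induction n with
  | zero =>
    have : annihilatedBy I (𝔞 ^ 0) = ⊥ := by
      rw [eq_bot_iff]
      intro x hx
      simpa using hx 1 (by simp)
    rw [this]
    infer_instance
  | succ n ih =>
    rw [pow_succ]
    exact isNoetherian_annihilatedBy_mul _ _ ih h𝔞

variable [IsArtinianRing R] {i : (R ⧸ Ring.jacobson R) →ₗ[R] I}

/-- The left side is a module over the semisimple ring `R / rad R`, so the range of `i` has a
complement in it. Essentiality forces this complement to be zero. -/
lemma IsInjectiveEnvelope.annihilatedBy_jacobson (hi : IsInjectiveEnvelope i) :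
    annihilatedBy I (Ring.jacobson R) = LinearMap.range i := by
  set S := annihilatedBy I (Ring.jacobson R)
  have hle : LinearMap.range i ≤ S := by
    rintro _ ⟨x, rfl⟩ a ha
    obtain ⟨x, rfl⟩ := Ideal.Quotient.mk_surjective x
    have hx : a • Ideal.Quotient.mk (Ring.jacobson R) x = 0 :=
      Ideal.Quotient.eq_zero_iff_mem.2 (Ideal.mul_mem_right x _ ha)
    rw [← map_smul, hx, map_zero]
  have hS : Module.IsTorsionBySet R S (Ring.jacobson R) := fun x a => Subtype.ext (x.2 a a.2)
  have hss : IsSemisimpleModule R S := by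
    let := hS.module
    exact hS.isSemisimpleModule_iff.1 inferInstance
  obtain ⟨K, hK⟩ := exists_isCompl ((LinearMap.range i).comap S.subtype)
  have hK0 : K.map S.subtype = ⊥ := hi.essential _ (by
    rw [eq_bot_iff]
    rintro _ ⟨⟨x, hx, rfl⟩, hx'⟩
    have := hK.disjoint.le_bot ⟨hx', hx⟩
    exact congrArg Subtype.val ((Submodule.mem_bot R).1 this))
  replace hK0 : K = ⊥ := Submodule.map_injective_of_injective S.injective_subtype
    (hK0.trans (Submodule.map_bot _).symm)
  have htop := hK.sup_eq_top
  rw [hK0, sup_bot_eq] at htop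
  refine le_antisymm (fun x hx => ?_) hle
  exact (htop.ge trivial : (⟨x, hx⟩ : S) ∈ _)

/-- Over an artinian ring, the injective envelope of `R / rad R` is a finitely generated module. -/
lemma IsInjectiveEnvelope.isNoetherian (hi : IsInjectiveEnvelope i) : IsNoetherian R I := by
  have h1 : IsNoetherian R (annihilatedBy I (Ring.jacobson R)) := by
    rw [hi.annihilatedBy_jacobson]
    infer_instance
  -- The radical is nilpotent, so one of its powers annihilates all of `I`.
  obtain ⟨n, hn⟩ := (inferInstance : IsSemiprimaryRing R).isNilpotent
  have h2 := isNoetherian_annihilatedBy_pow _ h1 n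
  have h3 : annihilatedBy I (Ring.jacobson R ^ n) = ⊤ := by
    rw [eq_top_iff, hn]
    rintro x - a ha
    rw [(Ideal.mem_bot).1 ha, zero_smul]
  rw [h3] at h2
  exact isNoetherian_of_linearEquiv Submodule.topEquiv

omit [AddCommGroup I] [Module R I] in
-- There are finitely many maximal ideals; take `x` outside `m` and inside all the others. The class
-- of `x` spans a copy of `R / m` in `R / rad R`.
lemma exists_notMem_jacobson_mul_mem (m : Ideal R) [hm : m.IsMaximal] :
    ∃ x ∉ Ring.jacobson R, ∀ r ∈ m, r * x ∈ Ring.jacobson R := by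
  classical
  have : Fintype (MaximalSpectrum R) := Fintype.ofFinite _
  let s : Finset (MaximalSpectrum R) := Finset.univ.erase ⟨m, hm⟩
  have hs : ¬ s.inf MaximalSpectrum.asIdeal ≤ m := by
    rw [hm.isPrime.inf_le']
    rintro ⟨n, hn, hnm⟩
    exact Finset.ne_of_mem_erase hn (MaximalSpectrum.ext (n.2.eq_of_le hm.ne_top hnm))
  obtain ⟨x, hx, hxm⟩ := SetLike.not_le_iff_exists.1 hs
  refine ⟨x, fun h => hxm (Ring.jacobson_le_of_isMaximal m h), fun r hr => ?_⟩
  rw [Ring.jacobson_eq_sInf_isMaximal, Ideal.mem_sInf]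
  intro n hn
  by_cases hnm : n = m
  · exact hnm ▸ m.mul_mem_right x hr
  · refine n.mul_mem_left r ((Finset.inf_le (f := MaximalSpectrum.asIdeal)
      (b := ⟨n, hn⟩) (Finset.mem_erase.2 ⟨fun h => hnm ?_, Finset.mem_univ _⟩)) hx)
    exact congrArg MaximalSpectrum.asIdeal h

/-- The injective envelope of `R / rad R` is a cogenerator. -/
lemma IsInjectiveEnvelope.subsingleton_of_forall_eq_zero (hi : IsInjectiveEnvelope i) {W : Type u}
    [AddCommGroup W] [Module R W] (hW : ∀ f : W →ₗ[R] I, f = 0) : Subsingleton W := by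
  refine subsingleton_of_forall_eq 0 fun w => by_contra fun hw => ?_
  let φ := LinearMap.toSpanSingleton R W w
  obtain ⟨m, hm, hle⟩ := Ideal.exists_le_maximal (LinearMap.ker φ) fun h => hw (by
    have h1 : (1 : R) ∈ LinearMap.ker φ := h ▸ Submodule.mem_top
    simpa [φ] using h1)
  obtain ⟨x, hx, hmx⟩ := exists_notMem_jacobson_mul_mem m
  -- The annihilator of `w` lies in `m`, which kills the class of `x`. Hence `w ↦ i(x)` is a
  -- well-defined nonzero map on `Rw`, and injectivity of `I` extends it to `W`.
  let ψ : R →ₗ[R] I := i.comp (LinearMap.toSpanSingleton R _ (Ideal.Quotient.mk _ x))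
  have hψ : LinearMap.ker φ ≤ LinearMap.ker ψ := fun r hr => by
    have h0 : r • Ideal.Quotient.mk (Ring.jacobson R) x = 0 :=
      Ideal.Quotient.eq_zero_iff_mem.2 (hmx r (hle hr))
    simp [ψ, h0]
  obtain ⟨f, hf⟩ := hi.injective_module.out ((LinearMap.ker φ).liftQ φ le_rfl)
    (LinearMap.ker_eq_bot.1 (Submodule.ker_liftQ_eq_bot _ _ _ le_rfl))
    ((LinearMap.ker φ).liftQ ψ hψ)
  have h1 := hf (Submodule.Quotient.mk 1)
  rw [hW f] at h1
  have h2 : i (Ideal.Quotient.mk _ x) = i 0 := by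
    rw [map_zero, ← one_smul R (Ideal.Quotient.mk _ x)]
    exact h1.symm
  exact hx (Ideal.Quotient.eq_zero_iff_mem.1 (hi.injective_map h2))

/-- `Hom(g, I)` is injective if and only if `g` is surjective. -/
lemma IsInjectiveEnvelope.surjective_of_forall (hi : IsInjectiveEnvelope i) {V W : Type u}
    [AddCommGroup V] [Module R V] [AddCommGroup W] [Module R W] (g : V →ₗ[R] W)
    (h : ∀ f : W →ₗ[R] I, f.comp g = 0 → f = 0) : Function.Surjective g := by
  have : Subsingleton (W ⧸ LinearMap.range g) := hi.subsingleton_of_forall_eq_zero fun f => by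
    have h' := h (f.comp (LinearMap.range g).mkQ) (by
      rw [LinearMap.comp_assoc, LinearMap.range_mkQ_comp, LinearMap.comp_zero])
    ext x
    exact LinearMap.congr_fun h' x
  rwa [← LinearMap.range_eq_top, ← Submodule.Quotient.subsingleton_iff]

/-- A map `ker g → I` extends to `V`, then factors through `g`, so it vanishes. As `I` is a
cogenerator, `ker g` is zero. -/
lemma IsInjectiveEnvelope.injective_of_forall (hi : IsInjectiveEnvelope i) {V W : Type u}
    [AddCommGroup V] [Module R V] [AddCommGroup W] [Module R W] (g : V →ₗ[R] W)
    (h : ∀ f : V →ₗ[R] I, ∃ f' : W →ₗ[R] I, f'.comp g = f) : Function.Injective g := by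
  have : Subsingleton (LinearMap.ker g) := hi.subsingleton_of_forall_eq_zero fun f => by
    obtain ⟨f', hf'⟩ := hi.injective_module.out (LinearMap.ker g).subtype
      (LinearMap.ker g).injective_subtype f
    obtain ⟨k, hk⟩ := h f'
    ext x
    rw [← hf', ← hk]
    simp
  rw [← LinearMap.ker_eq_bot]
  exact (Submodule.subsingleton_iff_eq_bot).1 this

end InjectiveEnvelope

/-! ### The duality `D Hom(M, X) ≅ Hom(X, νM)` for finitely generated projective `M` -/

section NakayamaDuality

/-- Split a surjection `Aⁿ → M`: `s` is the image of the standard basis and `h` gives the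
coordinates of the section. -/
lemma exists_dual_basis (A : Type u) [Ring A] (M : Type u) [AddCommGroup M] [Module A M]
    [Module.Finite A M] [Module.Projective A M] :
    ∃ (n : ℕ) (s : Fin n → M) (h : Fin n → (M →ₗ[A] A)), ∀ p : M, ∑ j, h j p • s j = p := by
  obtain ⟨n, f, g, -, -, hfg⟩ := Module.Finite.exists_comp_eq_id_of_projective A M
  refine ⟨n, fun j => f (Pi.single j 1), fun j => (LinearMap.proj j).comp g, fun p => ?_⟩
  conv_rhs => rw [← LinearMap.id_apply (R := A) p, ← hfg]
  simp only [LinearMap.comp_apply, LinearMap.proj_apply, ← map_smul, ← map_sum]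
  congr 1
  ext j
  simp [Finset.sum_apply, Pi.single_apply]

variable (R : Type u) [CommRing R] {A : Type u} [Ring A] [Algebra R A]
  (I : Type u) [AddCommGroup I] [Module R I]

section

variable {M N : Type u} [AddCommGroup M] [Module A M] [AddCommGroup N] [Module A N]
  {X Y : Type u} [AddCommGroup X] [Module A X] [Module R X] [IsScalarTower R A X]
  [AddCommGroup Y] [Module A Y] [Module R Y] [IsScalarTower R A Y]

variable (X) in
/-- Precomposition with `f : M → N`, as an `R`-linear map `Hom(N, X) → Hom(M, X)`. -/
def precomp (f : M →ₗ[A] N) : (N →ₗ[A] X) →ₗ[R] (M →ₗ[A] X) where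
  toFun h := h.comp f
  map_add' _ _ := rfl
  map_smul' _ _ := rfl

variable (M) in
/-- Postcomposition with `f : X → Y`, as an `R`-linear map `Hom(M, X) → Hom(M, Y)`. -/
def postcomp (f : X →ₗ[A] Y) : (M →ₗ[A] X) →ₗ[R] (M →ₗ[A] Y) where
  toFun h := f.comp h
  map_add' h k := LinearMap.ext fun x => map_add f (h x) (k x)
  map_smul' r h := LinearMap.ext fun x => (f.restrictScalars R).map_smul r (h x)

variable (M) in
/-- For `x : X`, the `R`-linear map `M^* → Hom(M, X)` that sends `h` to `p ↦ h(p) x`. -/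
def starSMul (x : X) : (M →ₗ[A] A) →ₗ[R] (M →ₗ[A] X) where
  toFun h := h.smulRight x
  map_add' h k := LinearMap.ext fun p => add_smul (h p) (k p) x
  map_smul' r h := LinearMap.ext fun p => smul_assoc r (h p) x

variable {R I}

lemma NakayamaDual.smul_apply (a : A) (φ : NakayamaDual R A I M) (h : M →ₗ[A] A) :
    (a • φ).toLin h = φ.toLin (starMul R M a h) := rfl

/-- The natural map `D Hom(M, X) → Hom(X, νM)`. -/
def toNakayama (ψ : (M →ₗ[A] X) →ₗ[R] I) : X →ₗ[A] NakayamaDual R A I M where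
  toFun x := ψ.comp (starSMul R M x)
  map_add' x y := LinearMap.ext fun h =>
    (congrArg ψ (LinearMap.ext fun p => smul_add (h p) x y)).trans (map_add ψ _ _)
  map_smul' a x := LinearMap.ext fun h =>
    congrArg ψ (LinearMap.ext fun p => (mul_smul (h p) a x).symm)

lemma toNakayama_apply (ψ : (M →ₗ[A] X) →ₗ[R] I) (x : X) (h : M →ₗ[A] A) :
    (toNakayama ψ x).toLin h = ψ (h.smulRight x) := rfl

lemma nakayamaMap_comp_toNakayama (f : M →ₗ[A] N) (ψ : (M →ₗ[A] X) →ₗ[R] I) :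
    (nakayamaMap R I f).comp (toNakayama ψ) = toNakayama (ψ.comp (precomp R X f)) := rfl

variable [Module.Finite A M] [Module.Projective A M]

/-- By the dual basis, `Hom(M, X)` is spanned additively by the maps `p ↦ h(p) x`, and on these `ψ`
is read off from `toNakayama ψ`. -/
lemma toNakayama_injective :
    Function.Injective (toNakayama : ((M →ₗ[A] X) →ₗ[R] I) → (X →ₗ[A] NakayamaDual R A I M)) := by
  obtain ⟨n, s, h, hs⟩ := exists_dual_basis A M
  intro ψ ψ' e
  ext g
  have hg : g = ∑ j, (h j).smulRight (g (s j)) := by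
    ext p
    conv_lhs => rw [← hs p]
    simp
  rw [hg, map_sum, map_sum]
  refine Finset.sum_congr rfl fun j _ => ?_
  rw [← toNakayama_apply, ← toNakayama_apply, e]

lemma toNakayama_surjective :
    Function.Surjective
      (toNakayama : ((M →ₗ[A] X) →ₗ[R] I) → (X →ₗ[A] NakayamaDual R A I M)) := by
  obtain ⟨n, s, h, hs⟩ := exists_dual_basis A M
  intro θ
  -- The formula is forced by `g = ∑ h_j(-) g(s_j)`.
  let ψ : (M →ₗ[A] X) →ₗ[R] I :=
    { toFun := fun g => ∑ j, (θ (g (s j))).toLin (h j)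
      map_add' := fun g k => by
        rw [← Finset.sum_add_distrib]
        refine Finset.sum_congr rfl fun j _ => ?_
        rw [LinearMap.add_apply, map_add]
        rfl
      map_smul' := fun r g => by
        rw [RingHom.id_apply, Finset.smul_sum]
        refine Finset.sum_congr rfl fun j _ => ?_
        rw [← map_smul, LinearMap.smul_apply, ← algebraMap_smul A r (g (s j)), map_smul,
          NakayamaDual.smul_apply]
        congr 1
        ext p
        -- Right multiplication by a scalar from `R` is scalar multiplication because `R` acts
        -- centrally on `A`.
        change h j p * algebraMap R A r = r • h j p
        rw [Algebra.smul_def, Algebra.commutes] }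
  refine ⟨ψ, LinearMap.ext fun x => LinearMap.ext fun k => ?_⟩
  change ∑ j, (θ (k (s j) • x)).toLin (h j) = (θ x).toLin k
  have hk : k = ∑ j, starMul R M (k (s j)) (h j) := by
    ext p
    conv_lhs => rw [← hs p]
    simp [starMul]
  conv_rhs => rw [hk, map_sum]
  refine Finset.sum_congr rfl fun j _ => ?_
  rw [map_smul, NakayamaDual.smul_apply]

end

section Bimodule

variable {R I} {M N : Type u} [AddCommGroup M] [Module A M] [AddCommGroup N] [Module A N]
  [Module.Finite A M] [Module.Projective A M] [Module.Finite A N] [Module.Projective A N]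

/-- `νM` is an injective module for a finitely generated projective module `M`. -/
lemma injective_nakayamaDual [Module.Injective R I] :
    Module.Injective A (NakayamaDual R A I M) where
  out X Y _ _ _ _ f hf g := by
    let : Module R X := Module.compHom X (algebraMap R A)
    let : Module R Y := Module.compHom Y (algebraMap R A)
    have : IsScalarTower R A X := .of_algebraMap_smul fun _ _ => rfl
    have : IsScalarTower R A Y := .of_algebraMap_smul fun _ _ => rfl
    obtain ⟨ψ, rfl⟩ := toNakayama_surjective g
    -- Through the duality, extending a map along `f` becomes extending a functional along `Hom(M,
    -- f)`, which is injective.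
    obtain ⟨ψ', hψ'⟩ := Module.Injective.out (postcomp R M f)
      (fun h k hhk => LinearMap.ext fun p => hf (LinearMap.congr_fun hhk p)) ψ
    refine ⟨toNakayama ψ', fun x => LinearMap.ext fun h => ?_⟩
    change ψ' (h.smulRight (f x)) = ψ (h.smulRight x)
    rw [← hψ']
    congr 1
    ext p
    exact (map_smul f (h p) x).symm

variable [IsArtinianRing R] {i : (R ⧸ Ring.jacobson R) →ₗ[R] I}

/-- `Hom(d, X)` is surjective if and only if `Hom(X, νd)` is injective. -/
lemma IsInjectiveEnvelope.forall_exists_comp_eq_iff (hi : IsInjectiveEnvelope i)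
    (d : M →ₗ[A] N) (X : Type u) [AddCommGroup X] [Module A X] :
    (∀ f : M →ₗ[A] X, ∃ g : N →ₗ[A] X, g.comp d = f) ↔
      ∀ θ : X →ₗ[A] NakayamaDual R A I M, (nakayamaMap R I d).comp θ = 0 → θ = 0 := by
  let : Module R X := Module.compHom X (algebraMap R A)
  have : IsScalarTower R A X := .of_algebraMap_smul fun _ _ => rfl
  constructor
  · intro h θ hθ
    obtain ⟨ψ, rfl⟩ := toNakayama_surjective θ
    rw [nakayamaMap_comp_toNakayama] at hθ
    have h0 : ψ.comp (precomp R X d) = 0 := toNakayama_injective hθ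
    have : ψ = 0 := by
      ext f
      obtain ⟨g, rfl⟩ := h f
      exact LinearMap.congr_fun h0 g
    rw [this]
    rfl
  · intro h
    refine hi.surjective_of_forall (precomp R X d) fun ψ hψ => ?_
    refine toNakayama_injective (h _ ?_)
    rw [nakayamaMap_comp_toNakayama, hψ]
    rfl

/-- `Hom(d, X)` is injective if and only if `Hom(X, νd)` is surjective. -/
lemma IsInjectiveEnvelope.forall_comp_eq_zero_iff (hi : IsInjectiveEnvelope i)
    (d : M →ₗ[A] N) (X : Type u) [AddCommGroup X] [Module A X] :
    (∀ g : N →ₗ[A] X, g.comp d = 0 → g = 0) ↔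
      ∀ θ : X →ₗ[A] NakayamaDual R A I N, ∃ θ' : X →ₗ[A] NakayamaDual R A I M,
        (nakayamaMap R I d).comp θ' = θ := by
  let : Module R X := Module.compHom X (algebraMap R A)
  have : IsScalarTower R A X := .of_algebraMap_smul fun _ _ => rfl
  constructor
  · intro h θ
    obtain ⟨ψ, rfl⟩ := toNakayama_surjective θ
    obtain ⟨ψ', hψ'⟩ := hi.injective_module.out (precomp R X d)
      ((injective_iff_map_eq_zero (precomp R X d)).2 h) ψ
    refine ⟨toNakayama ψ', ?_⟩
    rw [nakayamaMap_comp_toNakayama]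
    exact congrArg _ (LinearMap.ext hψ')
  · intro h
    refine (injective_iff_map_eq_zero (precomp R X d)).1
      (hi.injective_of_forall (precomp R X d) fun ψ => ?_)
    obtain ⟨θ', hθ'⟩ := h (toNakayama ψ)
    obtain ⟨ψ', rfl⟩ := toNakayama_surjective θ'
    exact ⟨ψ', toNakayama_injective hθ'⟩

instance : Module R (NakayamaDual R A I M) :=
  inferInstanceAs (Module R ((M →ₗ[A] A) →ₗ[R] I))

instance : IsScalarTower R A (NakayamaDual R A I M) where
  smul_assoc r a φ := LinearMap.ext fun h => by
    change φ.toLin (starMul R M (r • a) h) = r • φ.toLin (starMul R M a h)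
    rw [← map_smul]
    congr 1
    ext p
    exact mul_smul_comm r (h p) a

/-- `νM` is finitely generated for a finitely generated projective module `M`. -/
lemma IsInjectiveEnvelope.isNoetherian_nakayamaDual [Module.Finite R A]
    (hi : IsInjectiveEnvelope i) : IsNoetherian A (NakayamaDual R A I M) := by
  have := hi.isNoetherian
  obtain ⟨n, s, h, hs⟩ := exists_dual_basis A M
  -- Evaluation at the `s j` embeds `M^*` in `Aⁿ`, so `M^*` is finitely generated over `R`; then
  -- `Hom_R(M^*, I)` is noetherian because `I` is.
  let e : (M →ₗ[A] A) →ₗ[R] (Fin n → A) :=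
    LinearMap.pi fun j =>
      { toFun := fun k => k (s j), map_add' := fun _ _ => rfl, map_smul' := fun _ _ => rfl }
  have he : Function.Injective e := fun k k' hk => LinearMap.ext fun p => by
    rw [← hs p]
    simp only [map_sum, map_smul]
    exact Finset.sum_congr rfl fun j _ => congrArg (h j p • ·) (congrFun hk j)
  have : IsNoetherian R A := isNoetherian_of_isNoetherianRing_of_finite R A
  have : Module.Finite R (M →ₗ[A] A) := Module.Finite.of_injective e he
  have : IsNoetherian R (NakayamaDual R A I M) :=
    inferInstanceAs (IsNoetherian R ((M →ₗ[A] A) →ₗ[R] I))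
  exact isNoetherian_of_tower R this

end Bimodule

end NakayamaDuality

/-! ### Homology of two-term complexes -/

section TwoTerm

variable {C : Type u} [Category.{v} C] [Abelian C]

/-- With zero outgoing differential, homology is the object of opcycles, which is the cokernel of
the incoming differential. -/
lemma exists_epi_homology_exact (K : CochainComplex C ℤ) (hK : K.d 0 1 = 0) :
    ∃ (π : K.X 0 ⟶ K.homology 0) (w : K.d (-1) 0 ≫ π = 0),
      Epi π ∧ (ShortComplex.mk (K.d (-1) 0) π w).Exact := by
  have := K.isIso_homologyι 0 1 (by simp) hK
  have hS : (ShortComplex.mk (K.d (-1) 0) (K.pOpcycles 0) (by simp)).Exact :=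
    ShortComplex.exact_of_g_is_cokernel _ (K.opcyclesIsCokernel (-1) 0 (by simp))
  refine ⟨K.pOpcycles 0 ≫ inv (K.homologyι 0), by simp, inferInstance, ?_⟩
  exact ShortComplex.exact_of_iso (S₁ := ShortComplex.mk (K.d (-1) 0) (K.pOpcycles 0) (by simp))
    (ShortComplex.isoMk (Iso.refl _) (Iso.refl _)
      (asIso (K.homologyι 0)).symm (by simp) (by simp)) hS

lemma exists_mono_homology_exact (K : CochainComplex C ℤ) (hK : K.d (-2) (-1) = 0) :
    ∃ (i : K.homology (-1) ⟶ K.X (-1)) (w : i ≫ K.d (-1) 0 = 0),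
      Mono i ∧ (ShortComplex.mk i (K.d (-1) 0) w).Exact := by
  have := K.isIso_homologyπ (-2) (-1) (by simp) hK
  have hS : (ShortComplex.mk (K.iCycles (-1)) (K.d (-1) 0) (by simp)).Exact :=
    ShortComplex.exact_of_f_is_kernel _ (K.cyclesIsKernel (-1) 0 (by simp))
  refine ⟨inv (K.homologyπ (-1)) ≫ K.iCycles (-1), by simp, inferInstance, ?_⟩
  exact ShortComplex.exact_of_iso
    (S₁ := ShortComplex.mk (K.iCycles (-1)) (K.d (-1) 0) (by simp))
    (ShortComplex.isoMk (asIso (K.homologyπ (-1))) (Iso.refl _)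
      (Iso.refl _) (by simp) (by simp)) hS

variable (P : CochainComplex C ℤ) [P.IsStrictlyGE (-1)] [P.IsStrictlyLE 0]

lemma leftOrthogonal_shiftsOf_single_of_two_term {X : C} (hX : extendable (P.d (-1) 0) X)
    (hX' : separated (P.d (-1) 0) X) :
    (shiftsOf ((HomotopyCategory.quotient C (ComplexShape.up ℤ)).obj
        ((CochainComplex.singleFunctor C 0).obj X))).leftOrthogonal
      ((HomotopyCategory.quotient C (ComplexShape.up ℤ)).obj P) := by
  rw [leftOrthogonal_shiftsOf_single_iff]
  rintro p' p p'' rfl rfl f hf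
  -- Degree 0 uses injectivity of `Hom(d, X)` and degree -1 its surjectivity; in all other degrees
  -- `P` vanishes.
  by_cases h₁ : p' + 1 = 0
  · obtain rfl : p' = -1 := by lia
    exact ⟨0, by rw [comp_zero]; exact (hX' f hf).symm⟩
  by_cases h₂ : p' + 1 = -1
  · obtain rfl : p' = -2 := by lia
    exact hX f
  · refine ⟨0, ?_⟩
    by_cases h₃ : p' + 1 < -1
    · exact (P.isZero_of_isStrictlyGE (-1) _ h₃).eq_of_src _ _
    · exact (P.isZero_of_isStrictlyLE 0 _ (by lia)).eq_of_src _ _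

end TwoTerm

/-! ### Derived morphisms from a two-term complex to a module -/

section Derived

variable {C : Type u} [Category.{v} C] [Abelian C] [HasDerivedCategory.{w} C]
  (P : CochainComplex C ℤ) [P.IsKProjective]

/-- As `P⁻² = 0`, every map `P⁻¹ → X` is a cocycle. -/
lemma forall_derivedCategory_hom_single_shift_one_iff [P.IsStrictlyGE (-1)] (X : C) :
    (∀ f : DerivedCategory.Q.obj P ⟶
      ((DerivedCategory.singleFunctor C 0).obj X)⟦(1 : ℤ)⟧, f = 0) ↔
    extendable (P.d (-1) 0) X := by
  rw [forall_derivedCategory_hom_single_eq_zero_iff P X (-2) (-1) 0 1 (by simp) (by simp)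
    (by simp)]
  exact ⟨fun h f => h f ((P.isZero_of_isStrictlyGE (-1) (-2)).eq_of_src _ _), fun h f _ => h f⟩

/-- As `P¹ = 0`, only the zero map `P⁰ → X` is a coboundary. -/
lemma forall_derivedCategory_hom_single_iff [P.IsStrictlyLE 0] (X : C) :
    (∀ f : DerivedCategory.Q.obj P ⟶ (DerivedCategory.singleFunctor C 0).obj X, f = 0) ↔
    separated (P.d (-1) 0) X := by
  let e := (shiftFunctorZero (DerivedCategory C) ℤ).app
    ((DerivedCategory.singleFunctor C 0).obj X)
  have h₀ : (∀ f : DerivedCategory.Q.obj P ⟶ (DerivedCategory.singleFunctor C 0).obj X, f = 0) ↔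
      ∀ f : DerivedCategory.Q.obj P ⟶
        ((DerivedCategory.singleFunctor C 0).obj X)⟦(0 : ℤ)⟧, f = 0 := by
    constructor
    · intro h f
      rw [← cancel_mono e.hom, zero_comp]
      exact h _
    · intro h f
      rw [← cancel_mono e.inv, zero_comp]
      exact h _
  rw [h₀, forall_derivedCategory_hom_single_eq_zero_iff P X (-1) 0 1 0 (by simp) (by simp)
    (by simp)]
  refine ⟨fun h f hf => ?_, fun h f hf => ⟨0, by rw [comp_zero, h f hf]⟩⟩
  obtain ⟨g, hg⟩ := h f hf
  rw [← hg, (P.isZero_of_isStrictlyLE 0 1).eq_of_src g 0, comp_zero]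

end Derived

/-! ### Finitely generated modules -/

section Modules

variable {A : Type u} [Ring A]

lemma finite_isClosedUnderExtensions [IsNoetherianRing A] :
    ObjectProperty.IsClosedUnderExtensions (fun X : ModuleCat.{u} A => Module.Finite A X) where
  prop_X₂_of_shortExact {S} hS h₁ h₃ := by
    have := isNoetherian_of_isNoetherianRing_of_finite A S.X₁
    have := isNoetherian_of_isNoetherianRing_of_finite A S.X₃
    have := isNoetherian_of_range_eq_ker S.f.hom S.g.hom hS.exact.moduleCat_range_eq_ker
    infer_instance

lemma inf_isClosedUnderExtensions {C : Type u} [Category.{v} C] [HasZeroMorphisms C]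
    {S T : ObjectProperty C} (hS : S.IsClosedUnderExtensions) (hT : T.IsClosedUnderExtensions) :
    ObjectProperty.IsClosedUnderExtensions (fun X => S X ∧ T X) where
  prop_X₂_of_shortExact h h₁ h₃ :=
    ⟨hS.prop_X₂_of_shortExact h h₁.1 h₃.1, hT.prop_X₂_of_shortExact h h₁.2 h₃.2⟩

/-- For a noetherian module `X`, there is a homomorphism `p : Gⁿ → X` whose image contains the
image of every homomorphism `G → X`. -/
lemma exists_forall_range_le (G X : Type u) [AddCommGroup G] [Module A G] [AddCommGroup X]
    [Module A X] [IsNoetherian A X] :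
    ∃ (n : ℕ) (p : (Fin n → G) →ₗ[A] X), ∀ f : G →ₗ[A] X,
      LinearMap.range f ≤ LinearMap.range p := by
  obtain ⟨m, ⟨n, p, rfl⟩, hm⟩ := set_has_maximal_iff_noetherian.2 ‹IsNoetherian A X›
    {m | ∃ (n : ℕ) (p : (Fin n → G) →ₗ[A] X), m = LinearMap.range p} ⟨_, 0, 0, rfl⟩
  refine ⟨n, p, fun f => ?_⟩
  -- Adjoining `f` as a further summand cannot enlarge the maximal image.
  let q : (Fin (n + 1) → G) →ₗ[A] X :=
    p.comp (LinearMap.funLeft A G Fin.succ) + f.comp (LinearMap.proj 0)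
  have hp : LinearMap.range p ≤ LinearMap.range q := by
    rintro _ ⟨x, rfl⟩
    refine ⟨Fin.cons 0 x, ?_⟩
    change p (fun j => Fin.cons (α := fun _ => G) 0 x j.succ) + f 0 = p x
    simp
  have hf : LinearMap.range f ≤ LinearMap.range q := by
    rintro _ ⟨x, rfl⟩
    refine ⟨Fin.cons x 0, ?_⟩
    change p (fun j => Fin.cons (α := fun _ => G) x 0 j.succ) + f x = f x
    simp only [Fin.cons_succ, add_eq_right]
    exact map_zero p
  have := hm _ ⟨_, q, rfl⟩
  exact hf.trans (not_lt_iff_le_imp_ge.1 this hp)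

/-- For an artinian module `X`, there is a homomorphism `j : X → Gⁿ` whose kernel is contained in
the kernel of every homomorphism `X → G`. -/
lemma exists_forall_ker_le (G X : Type u) [AddCommGroup G] [Module A G] [AddCommGroup X]
    [Module A X] [IsArtinian A X] :
    ∃ (n : ℕ) (j : X →ₗ[A] (Fin n → G)), ∀ f : X →ₗ[A] G,
      LinearMap.ker j ≤ LinearMap.ker f := by
  obtain ⟨m, ⟨n, p, rfl⟩, hm⟩ := set_has_minimal_iff_artinian.2 ‹IsArtinian A X›
    {m | ∃ (n : ℕ) (p : X →ₗ[A] (Fin n → G)), m = LinearMap.ker p} ⟨_, 0, 0, rfl⟩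
  refine ⟨n, p, fun f => ?_⟩
  let q : X →ₗ[A] (Fin (n + 1) → G) :=
    LinearMap.pi (Fin.cons f fun j => (LinearMap.proj j).comp p)
  have hq : LinearMap.ker q = LinearMap.ker f ⊓ LinearMap.ker p := by
    ext x
    simp only [q, LinearMap.mem_ker, Submodule.mem_inf, funext_iff, LinearMap.pi_apply,
      Fin.forall_fin_succ, Fin.cons_zero, Fin.cons_succ]
    rfl
  have := not_lt_iff_le_imp_ge.1 (hm _ ⟨_, q, rfl⟩) (hq.le.trans inf_le_right)
  exact this.trans (hq.le.trans inf_le_left)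

end Modules

/-! ### Generation and cogeneration, tilting complexes -/

section Generation

variable {A : Type u} [Ring A]

/-- A short exact sequence `0 → W → X → X / W → 0`. -/
lemma shortExact_subtype_mkQ {X : ModuleCat.{u} A} (W : Submodule A X) :
    (ShortComplex.mk (ModuleCat.ofHom W.subtype) (ModuleCat.ofHom W.mkQ)
      (ModuleCat.hom_ext (LinearMap.ext fun x => by simp))).ShortExact where
  exact := ShortComplex.Exact.moduleCat_of_range_eq_ker _ _ (by simp)
  mono_f := (ModuleCat.mono_iff_injective _).2 W.injective_subtype
  epi_g := (ModuleCat.epi_iff_surjective _).2 W.mkQ_surjective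

variable {P₁ P₀ : ModuleCat.{u} A} {d : P₁ ⟶ P₀}

lemma extendable_pi {M : ModuleCat.{u} A} (hM : extendable d M) (n : ℕ) :
    extendable d (ModuleCat.of A (Fin n → M)) := fun f => by
  choose g hg using fun j : Fin n => hM (f ≫ ModuleCat.ofHom (LinearMap.proj j))
  refine ⟨ModuleCat.ofHom (LinearMap.pi fun j => (g j).hom), ?_⟩
  ext x j
  exact LinearMap.congr_fun (congrArg ModuleCat.Hom.hom (hg j)) x

lemma separated_pi {N : ModuleCat.{u} A} (hN : separated d N) (n : ℕ) :
    separated d (ModuleCat.of A (Fin n → N)) := fun g hg => by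
  ext x j
  have := hN (g ≫ ModuleCat.ofHom (LinearMap.proj j)) (by rw [reassoc_of% hg, zero_comp])
  exact LinearMap.congr_fun (congrArg ModuleCat.Hom.hom this) x

/-- Let `W ⊆ X` be the trace of `M`. It is a quotient of `Mⁿ`, hence extendable, so `Ext¹(M, W) = 0`
and every map `M → X/W` lifts to `X`. The lift has image in `W`, so `Hom(M, X/W) = 0`. Thus `X/W` is
separated, and as a quotient of `X` it is extendable; `h` makes it zero. -/
lemma generates_cokernel [IsNoetherianRing A] [Projective P₁] [Projective P₀]
    {M : ModuleCat.{u} A} {π : P₀ ⟶ M} {w : d ≫ π = 0} (hd : (ShortComplex.mk d π w).Exact)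
    [Epi π] (hM : extendable d M)
    (h : ∀ Z : ModuleCat.{u} A, extendable d Z → separated d Z → Subsingleton Z) :
    Generates M (fun X => extendable d X ∧ Module.Finite A X) := by
  rintro X ⟨hX, hfin⟩
  have := isNoetherian_of_isNoetherianRing_of_finite A X
  obtain ⟨n, p, hp⟩ := exists_forall_range_le (A := A) M X
  have hS := shortExact_subtype_mkQ (LinearMap.range p)
  have := hS.epi_g
  have hW : extendable d (ModuleCat.of A (LinearMap.range p)) := by
    have : Epi (ModuleCat.ofHom p.rangeRestrict) :=
      (ModuleCat.epi_iff_surjective _).2 p.surjective_rangeRestrict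
    exact extendable_of_epi (extendable_pi hM n) (ModuleCat.ofHom p.rangeRestrict)
  have hQ : extendable d (ModuleCat.of A (X ⧸ LinearMap.range p)) :=
    extendable_of_epi hX (ModuleCat.ofHom (LinearMap.range p).mkQ)
  have hQ' : separated d (ModuleCat.of A (X ⧸ LinearMap.range p)) := by
    rw [separated_iff_of_exact hd]
    intro f
    obtain ⟨g, rfl⟩ := exists_lift_of_ext_eq_zero hS (ext_eq_zero_of_extendable hd hW) f
    ext x
    exact (Submodule.Quotient.mk_eq_zero _).2 (hp g.hom ⟨x, rfl⟩)
  refine ⟨n, p, LinearMap.range_eq_top.1 ?_⟩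
  exact (Submodule.Quotient.subsingleton_iff).1 (h _ hQ hQ')

/-- Let `K ⊆ Y` be the common kernel of all maps `Y → N`. The quotient `Y/K` embeds in `Nⁿ`, hence
is separated, so `Ext¹(Y/K, N) = 0` and maps `K → N` extend to `Y`. Such extensions vanish on `K`,
so `Hom(K, N) = 0` and `K` is extendable; it is separated as a submodule of `Y`, hence zero by `h`.
-/
lemma cogenerates_kernel [IsArtinianRing A] {N J₁ J₀ : ModuleCat.{u} A} {i : N ⟶ J₁}
    {c : J₁ ⟶ J₀} [Injective J₁] {w : i ≫ c = 0} (hc : (ShortComplex.mk i c w).Exact) [Mono i]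
    (hN : separated d N)
    (hsep : ∀ Y, separated d Y → ∀ f : Y ⟶ J₀, ∃ g : Y ⟶ J₁, g ≫ c = f)
    (hext : ∀ X, (∀ f : X ⟶ N, f = 0) → extendable d X)
    (h : ∀ Z : ModuleCat.{u} A, extendable d Z → separated d Z → Subsingleton Z) :
    Cogenerates N (fun Y => separated d Y ∧ Module.Finite A Y) := by
  rintro Y ⟨hY, hfin⟩
  have : IsArtinian A Y := isArtinian_of_fg_of_artinian'
  obtain ⟨n, j, hj⟩ := exists_forall_ker_le (A := A) N Y
  have hS := shortExact_subtype_mkQ (LinearMap.ker j)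
  have := hS.mono_f
  have hQ : separated d (ModuleCat.of A (Y ⧸ LinearMap.ker j)) := by
    have : Mono (ModuleCat.ofHom ((LinearMap.ker j).liftQ j le_rfl)) :=
      (ModuleCat.mono_iff_injective _).2
        (LinearMap.ker_eq_bot.1 (Submodule.ker_liftQ_eq_bot _ _ _ le_rfl))
    exact separated_of_mono (separated_pi hN n) (ModuleCat.ofHom ((LinearMap.ker j).liftQ j le_rfl))
  have hK : separated d (ModuleCat.of A (LinearMap.ker j)) :=
    separated_of_mono hY (ModuleCat.ofHom (LinearMap.ker j).subtype)
  have hK' : extendable d (ModuleCat.of A (LinearMap.ker j)) := by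
    refine hext _ fun f => ?_
    obtain ⟨g, rfl⟩ := exists_extension_of_ext_eq_zero hS
      (ext_eq_zero_of_forall_exists_lift hc (hsep _ hQ)) f
    ext x
    exact hj g.hom x.2
  exact ⟨n, j, LinearMap.ker_eq_bot.1 (Submodule.subsingleton_iff_eq_bot.1 (h _ hK' hK))⟩

end Generation

section Tilting

variable {A : Type u} [Ring A] {P : CochainComplex (ModuleCat.{u} A) ℤ}

lemma IsBoundedProj.projective_X (hP : IsBoundedProj P) (n : ℤ) : Projective (P.X n) := by
  have := hP.projective n
  exact (IsProjective.iff_projective (P.X n)).1 this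

lemma IsBoundedProj.isKProjective (hP : IsBoundedProj P) : P.IsKProjective := by
  obtain ⟨a, b, -, hb⟩ := hP.bounded
  have := hP.projective_X
  exact CochainComplex.isKProjective_of_projective P b

lemma isBoundedProj_single (M : ModuleCat.{u} A) [Module.Finite A M] [Module.Projective A M] :
    IsBoundedProj ((CochainComplex.singleFunctor (ModuleCat.{u} A) 0).obj M) := by
  have hX (n : ℤ) : Subsingleton (((CochainComplex.singleFunctor (ModuleCat.{u} A) 0).obj M).X n) ∨
      Nonempty (M ≃ₗ[A] ((CochainComplex.singleFunctor (ModuleCat.{u} A) 0).obj M).X n) := by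
    by_cases hn : n = 0
    · subst hn
      exact Or.inr ⟨(HomologicalComplex.singleObjXSelf (.up ℤ) 0 M).symm.toLinearEquiv⟩
    · exact Or.inl (ModuleCat.subsingleton_of_isZero
        (HomologicalComplex.isZero_single_obj_X (.up ℤ) 0 M n hn))
  refine ⟨fun n => ?_, fun n => ?_, 0, 0, inferInstance, inferInstance⟩
  · obtain h | ⟨⟨e⟩⟩ := hX n
    · infer_instance
    · exact Module.Finite.equiv e
  · obtain h | ⟨⟨e⟩⟩ := hX n
    · infer_instance
    · exact Module.Projective.of_equiv e

/-- A module without non-zero morphisms from the shifts of a tilting complex is zero. -/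
lemma IsTiltingComplex.subsingleton_of_leftOrthogonal (hP : IsTiltingComplex P)
    {X : ModuleCat.{u} A}
    (hX : (shiftsOf ((HomotopyCategory.quotient (ModuleCat.{u} A) (ComplexShape.up ℤ)).obj
        ((CochainComplex.singleFunctor (ModuleCat.{u} A) 0).obj X))).leftOrthogonal
      ((HomotopyCategory.quotient (ModuleCat.{u} A) (ComplexShape.up ℤ)).obj P)) :
    Subsingleton X := by
  -- The left orthogonal of a shift-stable class is triangulated; it contains `add P`, hence also
  -- `A` placed in degree 0.
  have h := hP.generates _ inferInstance inferInstance (addClosure_le_leftOrthogonal _ hX) _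
    (isBoundedProj_single (ModuleCat.of A A))
  rw [leftOrthogonal_shiftsOf_single_iff] at h
  let e := HomologicalComplex.singleObjXSelf (.up ℤ) 0 (ModuleCat.of A A)
  refine subsingleton_of_forall_eq 0 fun x => ?_
  -- An element of `X` is a map `A → X`, and orthogonality makes it factor through a zero
  -- differential.
  let f : ModuleCat.of A A ⟶ X := ModuleCat.ofHom (LinearMap.toSpanSingleton A X x)
  obtain ⟨g, hg⟩ := h (-1) 0 1 (by simp) (by simp) (e.hom ≫ f) (by
    rw [CochainComplex.singleFunctor_obj_d, zero_comp])
  rw [CochainComplex.singleFunctor_obj_d, zero_comp] at hg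
  have hf : f = 0 := by
    rw [← cancel_epi e.hom, comp_zero]
    exact hg.symm
  have := LinearMap.congr_fun (congrArg ModuleCat.Hom.hom hf) (1 : A)
  simpa [f] using this

end Tilting

/-! ### Two-term tilting complexes and the Nakayama functor -/

section TwoTermTiltingComplex

variable {A : Type u} [Ring A] {P : CochainComplex (ModuleCat.{u} A) ℤ}

lemma IsTwoTerm.classXc_eq [HasDerivedCategory.{w} (ModuleCat.{u} A)] (hP₂ : IsTwoTerm P)
    (hP : IsBoundedProj P) :
    classXc P = fun X => extendable (P.d (-1) 0) X ∧ Module.Finite A X := by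
  have := hP₂.strictlyGE
  have := hP.isKProjective
  ext X
  exact and_congr_left' (forall_derivedCategory_hom_single_shift_one_iff P X)

lemma IsTwoTerm.classYc_eq [HasDerivedCategory.{w} (ModuleCat.{u} A)] (hP₂ : IsTwoTerm P)
    (hP : IsBoundedProj P) :
    classYc P = fun X => separated (P.d (-1) 0) X ∧ Module.Finite A X := by
  have := hP₂.strictlyLE
  have := hP.isKProjective
  ext X
  exact and_congr_left' (forall_derivedCategory_hom_single_iff P X)

lemma IsTiltingComplex.subsingleton_of_extendable_of_separated (hP : IsTiltingComplex P)
    (hP₂ : IsTwoTerm P) (Z : ModuleCat.{u} A) (hZ : extendable (P.d (-1) 0) Z)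
    (hZ' : separated (P.d (-1) 0) Z) : Subsingleton Z := by
  have := hP₂.strictlyGE
  have := hP₂.strictlyLE
  exact hP.subsingleton_of_leftOrthogonal (leftOrthogonal_shiftsOf_single_of_two_term P hZ hZ')

lemma IsTiltingComplex.extendable_of_exact (hP : IsTiltingComplex P) (hP₂ : IsTwoTerm P)
    {M : ModuleCat.{u} A} {π : P.X 0 ⟶ M} (w : P.d (-1) 0 ≫ π = 0) [Epi π] :
    extendable (P.d (-1) 0) M := by
  have := hP₂.strictlyGE
  have := hP₂.strictlyLE
  have := hP.isBoundedProj.projective_X (-1)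
  exact TwoTermTilting.extendable_of_exact w
    (exists_eq_comp_d_add_d_comp (hP.hom_shift_eq_zero 1 one_ne_zero))

end TwoTermTiltingComplex

section NakayamaFunctor

variable {R : Type u} [CommRing R] [IsArtinianRing R] {A : Type u} [Ring A] [Algebra R A]
  {I : Type u} [AddCommGroup I] [Module R I] {i : (R ⧸ Ring.jacobson R) →ₗ[R] I}
  {M N : ModuleCat.{u} A} [Module.Finite A M] [Module.Projective A M] [Module.Finite A N]
  [Module.Projective A N]

lemma IsInjectiveEnvelope.extendable_iff (hi : IsInjectiveEnvelope i) (d : M ⟶ N)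
    (X : ModuleCat.{u} A) :
    extendable d X ↔
      ∀ θ : X ⟶ (nakayama R A I).obj M, θ ≫ (nakayama R A I).map d = 0 → θ = 0 := by
  have h := hi.forall_exists_comp_eq_iff d.hom X
  constructor
  · intro hX θ hθ
    refine ModuleCat.hom_ext (h.1 (fun f => ?_) θ.hom (congrArg ModuleCat.Hom.hom hθ))
    obtain ⟨g, hg⟩ := hX (ModuleCat.ofHom f)
    exact ⟨g.hom, congrArg ModuleCat.Hom.hom hg⟩
  · intro hX f
    obtain ⟨g, hg⟩ := h.2 (fun θ hθ => congrArg ModuleCat.Hom.hom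
      (hX (ModuleCat.ofHom θ) (ModuleCat.hom_ext hθ))) f.hom
    exact ⟨ModuleCat.ofHom g, ModuleCat.hom_ext hg⟩

lemma IsInjectiveEnvelope.separated_iff (hi : IsInjectiveEnvelope i) (d : M ⟶ N)
    (X : ModuleCat.{u} A) :
    separated d X ↔ ∀ θ : X ⟶ (nakayama R A I).obj N,
      ∃ θ' : X ⟶ (nakayama R A I).obj M, θ' ≫ (nakayama R A I).map d = θ := by
  have h := hi.forall_comp_eq_zero_iff d.hom X
  constructor
  · intro hX θ
    obtain ⟨θ', hθ'⟩ := h.1 (fun g hg => congrArg ModuleCat.Hom.hom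
      (hX (ModuleCat.ofHom g) (ModuleCat.hom_ext hg))) θ.hom
    exact ⟨ModuleCat.ofHom θ', ModuleCat.hom_ext hθ'⟩
  · intro hX g hg
    refine ModuleCat.hom_ext (h.2 (fun θ => ?_) g.hom (congrArg ModuleCat.Hom.hom hg))
    obtain ⟨θ', hθ'⟩ := hX (ModuleCat.ofHom θ)
    exact ⟨θ'.hom, congrArg ModuleCat.Hom.hom hθ'⟩

/-- `X` has no non-zero morphisms to the kernel of `νd` if and only if `Hom(d, X)` is
surjective. -/
lemma IsInjectiveEnvelope.extendable_iff_of_exact (hi : IsInjectiveEnvelope i) (d : M ⟶ N)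
    {K : ModuleCat.{u} A} {k : K ⟶ (nakayama R A I).obj M} {w : k ≫ (nakayama R A I).map d = 0}
    (hk : (ShortComplex.mk k ((nakayama R A I).map d) w).Exact) [Mono k] (X : ModuleCat.{u} A) :
    extendable d X ↔ ∀ f : X ⟶ K, f = 0 := by
  rw [hi.extendable_iff]
  constructor
  · intro h f
    rw [← cancel_mono k, zero_comp]
    exact h _ (by rw [Category.assoc, w, comp_zero])
  · intro h θ hθ
    have : Mono (ShortComplex.mk k ((nakayama R A I).map d) w).f := ‹_›
    rw [← hk.lift_f θ hθ, h (hk.lift θ hθ), zero_comp]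

end NakayamaFunctor

end TwoTermTilting

theorem proposition5p7
    (R : Type u) [CommRing R] [IsArtinianRing R]
    (A : Type u) [Ring A] [Algebra R A] [Module.Finite R A]
    (I : Type u) [AddCommGroup I] [Module R I]
    (i : (R ⧸ Ring.jacobson R) →ₗ[R] I) (hi : TwoTermTilting.IsInjectiveEnvelope i)
    [HasDerivedCategory.{w} (ModuleCat.{u} A)]
    (P : CochainComplex (ModuleCat.{u} A) ℤ)
    (hP₂ : TwoTermTilting.IsTwoTerm P) (hP : TwoTermTilting.IsTiltingComplex P) :
    (TwoTermTilting.IsExtProjective (TwoTermTilting.classXc P) (P.homology 0) ∧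
      TwoTermTilting.Generates (P.homology 0) (TwoTermTilting.classXc P)) ∧
    (TwoTermTilting.IsExtInjective (TwoTermTilting.classYc P)
        ((TwoTermTilting.nakayamaComplex R A I P).homology (-1)) ∧
      TwoTermTilting.Cogenerates ((TwoTermTilting.nakayamaComplex R A I P).homology (-1))
        (TwoTermTilting.classYc P)) := by
  have : IsArtinianRing A := IsArtinianRing.of_finite R A
  have : IsNoetherianRing A := inferInstance
  have := hP₂.strictlyGE
  have := hP₂.strictlyLE
  have := hi.injective_module
  have hPp := hP.isBoundedProj
  have := hPp.finite
  have := hPp.projective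
  have := hPp.projective_X
  have hzero := hP.subsingleton_of_extendable_of_separated hP₂
  rw [hP₂.classXc_eq hPp, hP₂.classYc_eq hPp]
  obtain ⟨π, hπ, _, hπex⟩ := TwoTermTilting.exists_epi_homology_exact P
    ((P.isZero_of_isStrictlyLE 0 1).eq_of_tgt _ _)
  have hM : TwoTermTilting.extendable (P.d (-1) 0) (P.homology 0) := hP.extendable_of_exact hP₂ hπ
  let N := (TwoTermTilting.nakayamaComplex R A I P).homology (-1)
  obtain ⟨k, hk, hkm, hkex⟩ :=
    TwoTermTilting.exists_mono_homology_exact (TwoTermTilting.nakayamaComplex R A I P)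
    (((TwoTermTilting.nakayama R A I).map_isZero
      (P.isZero_of_isStrictlyGE (-1) (-2))).eq_of_src _ _)
  have hkm' : Mono (Y := (TwoTermTilting.nakayama R A I).obj (P.X (-1))) k := hkm
  have hext (X : ModuleCat.{u} A) :
      TwoTermTilting.extendable (P.d (-1) 0) X ↔ ∀ f : X ⟶ N, f = 0 :=
    hi.extendable_iff_of_exact (P.d (-1) 0) hkex X
  -- `Hom(M, N) = 0` is read in two ways: it expresses both `M ∈ 𝒳` and `N ∈ 𝒴`.
  have hN : TwoTermTilting.separated (P.d (-1) 0) N :=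
    (TwoTermTilting.separated_iff_of_exact hπex N).2 ((hext _).1 hM)
  have hinj : Injective ((TwoTermTilting.nakayamaComplex R A I P).X (-1)) := by
    have : Module.Injective A (TwoTermTilting.NakayamaDual R A I (P.X (-1))) :=
      TwoTermTilting.injective_nakayamaDual
    exact Module.injective_object_of_injective_module A _
  have hNfin : Module.Finite A N := by
    have : IsNoetherian A ((TwoTermTilting.nakayamaComplex R A I P).X (-1)) :=
      hi.isNoetherian_nakayamaDual (M := P.X (-1))
    exact Module.Finite.of_injective k.hom ((ModuleCat.mono_iff_injective k).1 hkm)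
  have hsep (Y : ModuleCat.{u} A) (hY : TwoTermTilting.separated (P.d (-1) 0) Y) :=
    (hi.separated_iff (P.d (-1) 0) Y).1 hY
  refine ⟨⟨⟨?_, ⟨hM, ?_⟩, fun X hX => TwoTermTilting.ext_eq_zero_of_extendable hπex hX.1⟩,
    TwoTermTilting.generates_cokernel hπex hM hzero⟩, ⟨?_, ⟨hN, hNfin⟩, fun Y hY => ?_⟩, ?_⟩
  · exact TwoTermTilting.inf_isClosedUnderExtensions
      (TwoTermTilting.extendable_isClosedUnderExtensions _)
      TwoTermTilting.finite_isClosedUnderExtensions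
  · exact Module.Finite.of_surjective π.hom ((ModuleCat.epi_iff_surjective π).1 ‹_›)
  · exact TwoTermTilting.inf_isClosedUnderExtensions
      (TwoTermTilting.separated_isClosedUnderExtensions _)
      TwoTermTilting.finite_isClosedUnderExtensions
  · exact TwoTermTilting.ext_eq_zero_of_forall_exists_lift hkex (hsep Y hY.1)
  · exact TwoTermTilting.cogenerates_kernel hkex hN hsep (fun X => (hext X).2) hzero
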